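/- **Impossibility of $\mathtt{BLIND}_{\mathtt{can}}$.** Consider families, indexed by the security parameter $\lambda\in\mathbb N$, of interactive quantum protocols between a trusted party Cupid, a server, and $n=n(\lambda)\ge 3$ applicants. Cupid's input is a string $\mathbf d_0\in\{0,1\}^n$; applicant $i$ is *supported* if $\mathbf d_0[i]=1$. At the end each applicant outputs one qubit. The protocol is *correct* if there is a negligible function $\delta$ such that, for every $\lambda$ and every $\mathbf d_0\neq 0$, after an honest run the joint state $\rho$ of the output qubits of the supported applicants has fidelity $\langle \mathrm{GHZ}|\rho|\mathrm{GHZ}\rangle\ge 1-\delta(\lambda)$ with the canonical GHZ state $\frac1{\sqrt2}(|0\cdots0\rangle+|1\cdots1\rangle)$. In the game $\mathtt{ImpossibleGame1}$ an adversary chooses a set $\mathcal M$ of corrupted applicants (it may in addition corrupt the server) and two strings $\mathbf d_0^{(0)},\mathbf d_0^{(1)}\in\{0,1\}^n$. If $\mathbf d_0^{(0)}[i]=0$ for all $i\notin\mathcal M$, or $\mathbf d_0^{(1)}[i]=0$ for all $i\notin\mathcal M$, the game returns false. Otherwise a uniform bit $c$ is drawn, the protocol is run with Cupid's input $\mathbf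 d_0^{(c)}$, the adversary playing the corrupted parties, and the adversary outputs a guess $\tilde c$; it wins iff $\tilde c=c$. It has *non-negligible advantage* if there is no negligible function $\nu$ such that it wins with probability at most $\frac12+\nu(\lambda)$ for all $\lambda$. Then: 1. There is no quantum polynomial time protocol family that is correct and for which every (non-uniform) quantum polynomial time adversary has negligible advantage in $\mathtt{ImpossibleGame1}$. 2. More precisely, for every correct protocol family (efficient or not) there is an adversary that wins $\mathtt{ImpossibleGame1}$ with non-negligible advantage, such that: it corrupts only applicants, not the server; its two strings differ only at positions in $\mathcal M$, so that only the corrupted applicants' own support status is to be guessed; the corrupted applicants follow the protocol during the run; after the run the adversary only measures in the computational basis and computes classically; and it is (non-uniform) quantum polynomial time whenever the protocol family is. -/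

import Mathlib

namespace BlindCan

open scoped Matrix

noncomputable section

/-! ## Negligible functions and polynomial bounds -/

/-- `ν` tends to `0` faster than every inverse polynomial in the security parameter. -/
def Negligible (ν : ℕ → ℝ) : Prop :=
  Asymptotics.SuperpolynomialDecay Filter.atTop (fun l : ℕ => (l : ℝ)) ν

def PolyBounded (f : ℕ → ℕ) : Prop :=
  ∃ p : Polynomial ℕ, ∀ l, f l ≤ p.eval l

/-! ## Quantum circuits

The qubits of a system are indexed by a finite type `W` of wires. A basis state is a bit
assignment `W → Bool`, and a (mixed) state is a density matrix indexed by these assignments. -/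

abbrev State (W : Type) := Matrix (W → Bool) (W → Bool) ℂ

/-- The pure computational basis state `|x⟩⟨x|`. -/
def basisState {W : Type} [DecidableEq W] [Fintype W] (x : W → Bool) : State W :=
  Matrix.single x x 1

/-- A gate: an arbitrary quantum channel on at most two distinct wires, given by its Kraus
operators. This covers unitary gates, measurements, resets, noise and coin tosses. -/
structure Gate (W : Type) where
  arity : ℕ
  arity_le : arity ≤ 2
  wires : Fin arity ↪ W
  rank : ℕ
  kraus : Fin rank → Matrix (Fin arity → Bool) (Fin arity → Bool) ℂ
  complete : ∑ j, (kraus j)ᴴ * kraus j = 1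

/-- The same gate, on renamed wires. -/
def Gate.map {W V : Type} (g : Gate W) (e : W ↪ V) : Gate V where
  arity := g.arity
  arity_le := g.arity_le
  wires := g.wires.trans e
  rank := g.rank
  kraus := g.kraus
  complete := g.complete

open Classical in
/-- A Kraus operator of a gate, tensored with the identity on all other wires. -/
def Gate.extend {W : Type} (g : Gate W) (j : Fin g.rank) : State W :=
  Matrix.of fun x y =>
    if ∀ w, w ∉ Set.range g.wires → x w = y w then
      g.kraus j (x ∘ g.wires) (y ∘ g.wires)
    else 0

def Gate.apply {W : Type} [Fintype W] [DecidableEq W] (g : Gate W) (ρ : State W) : State W :=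
  ∑ j, g.extend j * ρ * (g.extend j)ᴴ

/-- A gate that only reads its wires in the computational basis and writes computational basis
states: every Kraus operator is of the form `a |x⟩⟨y|` with basis states `x`, `y`. Such a gate is
a measurement in the computational basis followed by a classical randomized operation. -/
def Gate.IsComputationalBasis {W : Type} (g : Gate W) : Prop :=
  ∀ j, ∃ (x y : Fin g.arity → Bool) (a : ℂ), g.kraus j = Matrix.single x y a

/-- A circuit is a list of gates, applied from left to right; its size is its length. -/
abbrev Circuit (W : Type) := List (Gate W)

def Circuit.map {W V : Type} (C : Circuit W) (e : W ↪ V) : Circuit V :=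
  List.map (fun g => g.map e) C

def Circuit.apply {W : Type} [Fintype W] [DecidableEq W] (C : Circuit W) (ρ : State W) :
    State W :=
  List.foldl (fun σ g => g.apply σ) ρ C

/-- Move the content of every wire `w` to the wire `π w`. -/
def State.route {W : Type} (ρ : State W) (π : Equiv.Perm W) : State W :=
  Matrix.of fun x y => ρ (x ∘ π) (y ∘ π)

/-- Run `steps` steps; step `s` applies the circuit `C s` and then moves the qubits by `π s`. -/
def runSteps {W : Type} [Fintype W] [DecidableEq W] (steps : ℕ) (C : Fin steps → Circuit W)
    (π : Fin steps → Equiv.Perm W) (ρ : State W) : State W :=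
  (List.finRange steps).foldl (fun σ s => ((C s).apply σ).route (π s)) ρ

open Classical in
/-- The reduced state of the qubits on the wires `e i` (all other wires are traced out). -/
def State.reduced {W S : Type} [Fintype W] [DecidableEq W] (ρ : State W) (e : S ↪ W) : State S :=
  Matrix.of fun a b =>
    ∑ x : W → Bool, ∑ y : W → Bool,
      if x ∘ e = a ∧ y ∘ e = b ∧ ∀ w, w ∉ Set.range e → x w = y w then ρ x y else 0

/-- The probability that a measurement of the wire `w` in the computational basis gives `b`. -/
def State.probBit {W : Type} [Fintype W] [DecidableEq W] (ρ : State W) (w : W) (b : Bool) : ℝ :=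
  ∑ x : W → Bool, if x w = b then (ρ x x).re else 0

open Classical in
/-- The canonical GHZ state `(|0…0⟩ + |1…1⟩)/√2` on the (nonempty) family `S` of qubits. -/
def ghz (S : Type) : (S → Bool) → ℂ := fun x =>
  if x = (fun _ => false) ∨ x = (fun _ => true) then ((1 / Real.sqrt 2 : ℝ) : ℂ) else 0

/-- The fidelity `⟨GHZ|ρ|GHZ⟩`. -/
def ghzFidelity {S : Type} [Fintype S] [DecidableEq S] (ρ : State S) : ℝ :=
  (star (ghz S) ⬝ᵥ (ρ *ᵥ ghz S)).re

/-! ## Protocols -/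

/-- The parties: the trusted party Cupid, the server, and `n` applicants. -/
inductive Party (n : ℕ) where
  | cupid : Party n
  | server : Party n
  | applicant (i : Fin n) : Party n
  deriving DecidableEq, Fintype

/-- An interactive quantum protocol between Cupid, the server and `n` applicants.
Every party has a local register of qubits. Cupid's input `d` is written on the qubits `input i`
of Cupid, all other qubits start in `|0⟩`. In each step the active party applies a circuit to its
own register, and then qubits are exchanged between the registers along private channels
(`route`): the content of wire `w` moves to wire `route s w`. The output of applicant `i` is the
qubit `output i` of its register after the last step. Classical computation and classical
messages are the special case in which the qubits concerned are measured. -/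
structure Protocol (n : ℕ) where
  qubits : Party n → ℕ
  input : Fin n ↪ Fin (qubits Party.cupid)
  output : ∀ i : Fin n, Fin (qubits (Party.applicant i))
  steps : ℕ
  active : Fin steps → Party n
  act : ∀ s, Circuit (Fin (qubits (active s)))
  route : Fin steps → Equiv.Perm (Σ p, Fin (qubits p))

namespace Protocol

variable {n : ℕ} (P : Protocol n)

abbrev Wire : Type := Σ p, Fin (P.qubits p)

/-- The register of party `p` inside the whole system. -/
def register (p : Party n) : Fin (P.qubits p) ↪ P.Wire where
  toFun k := ⟨p, k⟩
  inj' := by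
    intro k k' h
    simpa using h

def outputWire : Fin n ↪ P.Wire where
  toFun i := ⟨Party.applicant i, P.output i⟩
  inj' := by
    intro i j h
    have h1 := congrArg Sigma.fst h
    simpa using h1

open Classical in
/-- The initial bits of all wires when Cupid's input is `d`. -/
def initialBits (d : Fin n → Bool) : P.Wire → Bool := fun w =>
  decide (∃ i, d i = true ∧ w = ⟨Party.cupid, P.input i⟩)

/-- The joint final state of all parties after an honest run with support `d`. -/
def honestRun (d : Fin n → Bool) : State P.Wire :=
  runSteps P.steps (fun s => (P.act s).map (P.register (P.active s))) P.route
    (basisState (P.initialBits d))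

/-- The joint state of the output qubits of the supported applicants after an honest run. -/
def supportedState (d : Fin n → Bool) : State {i : Fin n // d i = true} :=
  (P.honestRun d).reduced ((Function.Embedding.subtype fun i => d i = true).trans P.outputWire)

/-- The total number of qubits, steps and gates. -/
def size : ℕ :=
  (∑ p, P.qubits p) + P.steps + ∑ s, (P.act s).length

end Protocol

/-- A family of protocols, one per security parameter, is quantum polynomial time. -/
def IsQPTProtocol {n : ℕ → ℕ} (P : ∀ l, Protocol (n l)) : Prop :=
  PolyBounded fun l => (P l).size

/-- Correctness: after an honest run with any nonempty support, the supported applicants share a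
canonical GHZ state, up to a negligible error. -/
def IsCorrect {n : ℕ → ℕ} (P : ∀ l, Protocol (n l)) : Prop :=
  ∃ δ : ℕ → ℝ, Negligible δ ∧
    ∀ l (d : Fin (n l) → Bool), (∃ i, d i = true) →
      1 - δ l ≤ ghzFidelity ((P l).supportedState d)

/-! ## Adversaries and the game -/

/-- The corrupted parties: the applicants in `M`, and the server if `srv` holds. Cupid is always
honest. -/
def Corrupted {n : ℕ} (M : Finset (Fin n)) (srv : Bool) : Party n → Prop
  | Party.cupid => False
  | Party.server => srv = true
  | Party.applicant i => i ∈ M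

/-- An adversary against the protocol `P`. It chooses the set `M` of corrupted applicants (and
possibly corrupts the server) and two supports `d false`, `d true`. Whenever a corrupted party is
active it applies a circuit of its choice to the registers of all corrupted parties and its own
workspace; at the end it applies the circuit `final` and reads its guess from a workspace qubit. -/
structure Adversary {n : ℕ} (P : Protocol n) where
  M : Finset (Fin n)
  corruptServer : Bool
  d : Bool → Fin n → Bool
  workspace : ℕ
  act : Fin P.steps → Circuit ({w : P.Wire // Corrupted M corruptServer w.1} ⊕ Fin workspace)
  final : Circuit ({w : P.Wire // Corrupted M corruptServer w.1} ⊕ Fin workspace)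
  guess : Fin workspace

namespace Adversary

variable {n : ℕ} {P : Protocol n} (A : Adversary P)

/-- The wires accessible to the adversary. -/
abbrev Held : Type := {w : P.Wire // Corrupted A.M A.corruptServer w.1} ⊕ Fin A.workspace

/-- All wires of the attacked system. -/
abbrev Total : Type := P.Wire ⊕ Fin A.workspace

def heldWires : A.Held ↪ A.Total :=
  Function.Embedding.sumMap (Function.Embedding.subtype _) (Function.Embedding.refl _)

/-- The register of a corrupted party, as part of the wires of the adversary. -/
def corruptedRegister (p : Party n) (hp : Corrupted A.M A.corruptServer p) :
    Fin (P.qubits p) ↪ A.Held where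
  toFun k := Sum.inl ⟨⟨p, k⟩, hp⟩
  inj' := by
    intro k k' h
    simpa using h

open Classical in
/-- The circuit applied in step `s`: the adversary's if the active party is corrupted, the one
prescribed by the protocol otherwise. -/
def stepCircuit (s : Fin P.steps) : Circuit A.Total :=
  if Corrupted A.M A.corruptServer (P.active s) then (A.act s).map A.heldWires
  else (P.act s).map ((P.register (P.active s)).trans Function.Embedding.inl)

/-- The final state of the run of the protocol with the adversary when Cupid's input is `d`. -/
def attackedRun (d : Fin n → Bool) : State A.Total :=
  (A.final.map A.heldWires).apply
    (runSteps P.steps A.stepCircuit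
      (fun s => Equiv.sumCongr (P.route s) (Equiv.refl (Fin A.workspace)))
      (basisState (Sum.elim (P.initialBits d) fun _ => false)))

/-- At least one honest applicant is supported, in both challenges. -/
def Admissible : Prop := ∀ c, ∃ i, i ∉ A.M ∧ A.d c i = true

open Classical in
/-- The probability to win `ImpossibleGame1`. The game returns `false` if the challenges are not
admissible. Otherwise a uniform bit `c` is drawn, the protocol is run with the adversary and
Cupid's input `d c`, and the adversary wins if its guess is `c`. -/
def winProb : ℝ :=
  if A.Admissible then
    ∑ c : Bool, (1 / 2 : ℝ) * (A.attackedRun (A.d c)).probBit (Sum.inr A.guess) c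
  else 0

/-- During the run the corrupted parties do exactly what the protocol prescribes. -/
def FollowsProtocol : Prop :=
  ∀ s (hs : Corrupted A.M A.corruptServer (P.active s)),
    A.act s = (P.act s).map (A.corruptedRegister (P.active s) hs)

/-- After the run the adversary only measures in the computational basis and computes
classically. -/
def MeasuresComputationalBasis : Prop := ∀ g ∈ A.final, g.IsComputationalBasis

/-- The number of workspace qubits and gates. -/
def size : ℕ := A.workspace + (∑ s, (A.act s).length) + A.final.length

end Adversary

/-- A family of adversaries is (non-uniform) quantum polynomial time. -/
def IsQPTAdversary {n : ℕ → ℕ} {P : ∀ l, Protocol (n l)} (A : ∀ l, Adversary (P l)) : Prop :=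
  PolyBounded fun l => (A l).size

/-- The probability to win is at most `1/2` plus a negligible function. -/
def HasNegligibleAdvantage {n : ℕ → ℕ} {P : ∀ l, Protocol (n l)}
    (A : ∀ l, Adversary (P l)) : Prop :=
  ∃ ν : ℕ → ℝ, Negligible ν ∧ ∀ l, (A l).winProb ≤ 1 / 2 + ν l

/-- Security: no quantum polynomial time adversary wins `ImpossibleGame1` with non-negligible
advantage. -/
def HidesSupportStatus {n : ℕ → ℕ} (P : ∀ l, Protocol (n l)) : Prop :=
  ∀ A : ∀ l, Adversary (P l), IsQPTAdversary A → HasNegligibleAdvantage A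

end

end BlindCan

/-!
A correct protocol leaks the support status of a corrupted applicant because of two properties of
the GHZ state `(|0…0⟩ + |1…1⟩)/√2` held by the supported applicants. When its qubits are measured in
the computational basis, all results are equal. And since it is pure, a qubit outside of it is
uncorrelated with it, so the result for such a qubit cannot always agree with the result for a
qubit of the GHZ state.

So let the adversary corrupt two applicants `i` and `j`, follow the protocol, and finally compute
the parity of the two output bits. With support `{i, j, k}` the parity is almost always `0`
(`State.IsDensity.prob_ne_le`); with support `{i, k}` it is `1` with probability bounded away from
zero (`State.IsDensity.le_prob_ne`). The honest applicant `k` is supported in both cases, and the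
challenges differ only at `j`. A failure of correctness by `δ` leaves a winning probability of at
least `2 / 3 - 7 / 6 * δ` (`le_parityAdversary_winProb`).

Both estimates are made directly on the density matrix `ρ` of the whole system. The fidelity of a
reduced state with the GHZ state is half the sum of `ρ x x + ρ x (flipOn e x)` over the basis states
`x` that are constant on the subsystem (`ghzFidelity_reduced`), where `flipOn e` negates the bits of
the subsystem. Positivity of `ρ` bounds the coherence `ρ x (flipOn e x)` by diagonal entries, that
is, by probabilities of measurement results. A bit outside of the subsystem is not changed by
`flipOn e`, which therefore exchanges the results that agree with this bit and those that differ
from it.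

The run with this adversary is the honest run next to an idle workspace, because channels on one
factor of a tensor product act on this factor alone (`runSteps_tensor`). The two final gates act on
the diagonal of the density matrix as a classical function (`sum_classicalGate_diag_re`).
-/

namespace BlindCan

open scoped Matrix Kronecker ComplexOrder

/-! ### Density matrices -/

section States

variable {W : Type} [Fintype W] [DecidableEq W]

theorem Gate.extend_of_agree {W : Type} (g : Gate W) (j : Fin g.rank) {x y : W → Bool}
    (h : ∀ w, w ∉ Set.range g.wires → x w = y w) :
    g.extend j x y = g.kraus j (x ∘ g.wires) (y ∘ g.wires) :=
  if_pos h

theorem Gate.extend_of_not_agree {W : Type} (g : Gate W) (j : Fin g.rank) {x y : W → Bool}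
    (h : ¬∀ w, w ∉ Set.range g.wires → x w = y w) : g.extend j x y = 0 :=
  if_neg h

/-- The Kraus operators of a gate, extended to the whole system, satisfy the completeness relation,
so that gates preserve the trace. -/
theorem Gate.extend_completeness (g : Gate W) :
    ∑ j, (g.extend j)ᴴ * g.extend j = 1 := by
  classical
  ext x y
  have key : ∀ j, ((g.extend j)ᴴ * g.extend j) x y =
      if ∀ w, w ∉ Set.range g.wires → x w = y w then
        ((g.kraus j)ᴴ * g.kraus j) (x ∘ g.wires) (y ∘ g.wires) else 0 := by
    intro j
    rw [Matrix.mul_apply, Matrix.mul_apply]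
    have hinj : Function.Injective fun k : Fin g.arity → Bool =>
        Function.extend g.wires k x := by
      intro k k' h
      ext i
      simpa [g.wires.injective.extend_apply] using congrFun h (g.wires i)
    -- Only the assignments that agree with `x` off the wires of the gate contribute to the product.
    rw [← Fintype.sum_of_injective _ hinj
      (fun k => if ∀ w, w ∉ Set.range g.wires → x w = y w then
        (g.kraus j)ᴴ (x ∘ g.wires) k * g.kraus j k (y ∘ g.wires) else 0)]
    · split_ifs <;> simp
    · intro z hz
      rw [Matrix.conjTranspose_apply, Gate.extend, Matrix.of_apply, if_neg, star_zero, zero_mul]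
      intro h
      refine hz ⟨z ∘ g.wires, ?_⟩
      ext w
      by_cases hw : w ∈ Set.range g.wires
      · obtain ⟨i, rfl⟩ := hw
        simp [g.wires.injective.extend_apply]
      · simp only
        rw [Function.extend_apply' _ _ _ hw, h w hw]
    · intro k
      have hoff : ∀ w, w ∉ Set.range g.wires → Function.extend g.wires k x w = x w :=
        fun w hw => Function.extend_apply' _ _ _ hw
      have hon : Function.extend g.wires k x ∘ g.wires = k := by
        ext i
        simp [g.wires.injective.extend_apply]
      have hiff : (∀ w, w ∉ Set.range g.wires → Function.extend g.wires k x w = y w) ↔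
          ∀ w, w ∉ Set.range g.wires → x w = y w :=
        forall₂_congr fun w hw => by rw [hoff w hw]
      simp only [Gate.extend, Matrix.conjTranspose_apply, Matrix.of_apply, hiff, hon]
      rw [if_pos hoff]
      split_ifs <;> simp
  rw [Matrix.sum_apply, Finset.sum_congr rfl fun j _ => key j]
  have hxy : x = y ↔ (∀ w, w ∉ Set.range g.wires → x w = y w) ∧ x ∘ g.wires = y ∘ g.wires := by
    refine ⟨by rintro rfl; simp, fun ⟨h, h'⟩ => funext fun w => ?_⟩
    by_cases hw : w ∈ Set.range g.wires
    · obtain ⟨i, rfl⟩ := hw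
      exact congrFun h' i
    · exact h w hw
  by_cases h : ∀ w, w ∉ Set.range g.wires → x w = y w
  · simp only [if_pos h]
    rw [← Matrix.sum_apply, g.complete, Matrix.one_apply, Matrix.one_apply]
    exact if_congr (by rw [hxy, and_iff_right h]) rfl rfl
  · simp only [if_neg h, Finset.sum_const_zero]
    rw [Matrix.one_apply_ne fun e => h (hxy.1 e).1]

/-- A density matrix: positive semidefinite with trace one. -/
structure State.IsDensity (ρ : State W) : Prop where
  posSemidef : ρ.PosSemidef
  trace_eq_one : ρ.trace = 1

theorem isDensity_basisState (x : W → Bool) : (basisState x).IsDensity where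
  posSemidef := by
    have h : basisState x = Matrix.vecMulVec (Pi.single x 1) (star (Pi.single x 1)) := by
      ext y z
      simp [basisState, Matrix.single_apply, Matrix.vecMulVec_apply, Pi.single_apply]
      grind
    rw [h]
    exact Matrix.posSemidef_vecMulVec_self_star _
  trace_eq_one := by simp [basisState]

theorem State.IsDensity.gate_apply {ρ : State W} (h : ρ.IsDensity) (g : Gate W) :
    (g.apply ρ).IsDensity where
  posSemidef := Matrix.posSemidef_sum Finset.univ fun _ _ =>
    h.posSemidef.mul_mul_conjTranspose_same _
  trace_eq_one := by
    rw [Gate.apply, Matrix.trace_sum]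
    simp_rw [Matrix.trace_mul_comm (_ * ρ), ← mul_assoc]
    rw [← Matrix.trace_sum, ← Finset.sum_mul, g.extend_completeness, one_mul, h.trace_eq_one]

theorem State.IsDensity.circuit_apply {ρ : State W} (h : ρ.IsDensity) (C : Circuit W) :
    (C.apply ρ).IsDensity := by
  induction C generalizing ρ with
  | nil => exact h
  | cons g C ih => exact ih (h.gate_apply g)

theorem State.IsDensity.route {ρ : State W} (h : ρ.IsDensity) (π : Equiv.Perm W) :
    (ρ.route π).IsDensity where
  posSemidef := h.posSemidef.submatrix fun x => x ∘ π
  trace_eq_one := by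
    rw [← h.trace_eq_one]
    exact Equiv.sum_comp (Equiv.arrowCongr π.symm (Equiv.refl Bool)) fun x => ρ x x

theorem State.IsDensity.runSteps {ρ : State W} (h : ρ.IsDensity) (steps : ℕ)
    (C : Fin steps → Circuit W) (π : Fin steps → Equiv.Perm W) :
    (runSteps steps C π ρ).IsDensity := by
  unfold BlindCan.runSteps
  generalize List.finRange steps = L
  induction L generalizing ρ with
  | nil => exact h
  | cons s L ih => exact ih ((h.circuit_apply _).route _)

theorem State.IsDensity.sum_diag_re {ρ : State W} (h : ρ.IsDensity) :
    ∑ x, (ρ x x).re = 1 := by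
  rw [← Complex.re_sum]
  exact congrArg Complex.re h.trace_eq_one

theorem State.IsDensity.diag_re_nonneg {ρ : State W} (h : ρ.IsDensity) (x : W → Bool) :
    0 ≤ (ρ x x).re :=
  (Complex.nonneg_iff.1 (h.posSemidef.diag_nonneg (i := x))).1

theorem State.IsDensity.re_apply_comm {ρ : State W} (h : ρ.IsDensity) (x y : W → Bool) :
    (ρ y x).re = (ρ x y).re := by
  rw [← h.posSemidef.isHermitian.apply x y, Complex.star_def, Complex.conj_re]

/-- Positivity of `ρ` on the vector `|x⟩ - a |y⟩`. -/
theorem State.IsDensity.offDiag_re_le {ρ : State W} (h : ρ.IsDensity) (x y : W → Bool) (a : ℝ) :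
    2 * a * (ρ x y).re ≤ (ρ x x).re + a ^ 2 * (ρ y y).re := by
  have key := (Complex.nonneg_iff.1
    (h.posSemidef.dotProduct_mulVec_nonneg (Pi.single x 1 - (a : ℂ) • Pi.single y 1))).1
  have hxy := h.re_apply_comm x y
  simp [Matrix.mulVec_sub, Matrix.mulVec_smul, sub_dotProduct, dotProduct_sub] at key
  rw [hxy] at key
  linarith

end States

/-! ### Circuits on one factor of a tensor product -/

section Workspace

/-- The product state `ρ ⊗ τ` of two disjoint systems. -/
def State.tensor {W T : Type} (ρ : State W) (τ : State T) : State (W ⊕ T) :=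
  (ρ ⊗ₖ τ).submatrix (Equiv.sumArrowEquivProdArrow W T Bool)
    (Equiv.sumArrowEquivProdArrow W T Bool)

theorem State.tensor_apply {W T : Type} (ρ : State W) (τ : State T) (x y : W ⊕ T → Bool) :
    State.tensor ρ τ x y = ρ (x ∘ Sum.inl) (y ∘ Sum.inl) * τ (x ∘ Sum.inr) (y ∘ Sum.inr) := rfl

theorem State.route_tensor {W T : Type} (ρ : State W) (τ : State T) (π : Equiv.Perm W) :
    State.route (State.tensor ρ τ) (Equiv.sumCongr π (Equiv.refl T)) =
      State.tensor (ρ.route π) τ := rfl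

variable {W T : Type} [Fintype W] [DecidableEq W] [Fintype T]

theorem Gate.extend_map_inl (g : Gate W) (j : Fin g.rank) :
    (g.map (Function.Embedding.inl : W ↪ W ⊕ T)).extend j = State.tensor (g.extend j) 1 := by
  classical
  ext x y
  have h : (∀ w, w ∉ Set.range (g.map (Function.Embedding.inl : W ↪ W ⊕ T)).wires → x w = y w) ↔
      (∀ w, w ∉ Set.range g.wires → (x ∘ Sum.inl) w = (y ∘ Sum.inl) w) ∧
        x ∘ Sum.inr = y ∘ Sum.inr := by
    have hw : Set.range (g.map (Function.Embedding.inl : W ↪ W ⊕ T)).wires =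
        Sum.inl '' Set.range g.wires := Set.range_comp Sum.inl g.wires
    rw [hw]
    simp [Sum.forall, funext_iff]
  rw [State.tensor_apply, Matrix.one_apply]
  by_cases hx : ∀ w, w ∉ Set.range g.wires → (x ∘ Sum.inl) w = (y ∘ Sum.inl) w
  · by_cases hr : x ∘ Sum.inr = y ∘ Sum.inr
    · rw [if_pos hr, mul_one, g.extend_of_agree j hx]
      exact Gate.extend_of_agree _ _ (h.2 ⟨hx, hr⟩)
    · rw [if_neg hr, mul_zero]
      exact Gate.extend_of_not_agree _ _ fun h' => hr (h.1 h').2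
  · rw [g.extend_of_not_agree j hx, zero_mul]
    exact Gate.extend_of_not_agree _ _ fun h' => hx (h.1 h').1

theorem Gate.apply_map_inl [DecidableEq T] (g : Gate W) (ρ : State W) (τ : State T) :
    (g.map Function.Embedding.inl).apply (State.tensor ρ τ) = State.tensor (g.apply ρ) τ := by
  have h : ∀ j : Fin g.rank,
      (g.map (Function.Embedding.inl : W ↪ W ⊕ T)).extend j * State.tensor ρ τ *
        ((g.map (Function.Embedding.inl : W ↪ W ⊕ T)).extend j)ᴴ =
        State.tensor (g.extend j * ρ * (g.extend j)ᴴ) τ := by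
    intro j
    rw [Gate.extend_map_inl]
    simp only [State.tensor, Matrix.conjTranspose_submatrix, Matrix.submatrix_mul_equiv,
      Matrix.conjTranspose_kronecker, ← Matrix.mul_kronecker_mul, Matrix.conjTranspose_one,
      one_mul, mul_one]
  ext x y
  rw [State.tensor_apply, Gate.apply, Gate.apply, Matrix.sum_apply, Matrix.sum_apply, Finset.sum_mul]
  exact Finset.sum_congr rfl fun j _ => congrFun (congrFun (h j) x) y

theorem Circuit.apply_map_inl [DecidableEq T] (C : Circuit W) (ρ : State W) (τ : State T) :
    (C.map Function.Embedding.inl).apply (State.tensor ρ τ) = State.tensor (C.apply ρ) τ := by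
  induction C generalizing ρ with
  | nil => rfl
  | cons g C ih =>
    simp only [Circuit.map, Circuit.apply, List.map_cons, List.foldl_cons] at ih ⊢
    rw [Gate.apply_map_inl, ih]

theorem runSteps_tensor [DecidableEq T] (steps : ℕ) (C : Fin steps → Circuit W)
    (π : Fin steps → Equiv.Perm W)
    (ρ : State W) (τ : State T) :
    runSteps steps (fun s => (C s).map Function.Embedding.inl)
      (fun s => Equiv.sumCongr (π s) (Equiv.refl T)) (State.tensor ρ τ) =
        State.tensor (runSteps steps C π ρ) τ := by
  unfold runSteps
  generalize List.finRange steps = L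
  induction L generalizing ρ with
  | nil => rfl
  | cons s L ih =>
    rw [List.foldl_cons, List.foldl_cons, Circuit.apply_map_inl, State.route_tensor, ih]

theorem basisState_sumElim [DecidableEq T] (x : W → Bool) (t : T → Bool) :
    basisState (Sum.elim x t) = State.tensor (basisState x) (basisState t) := by
  ext y z
  have h : ∀ y : W ⊕ T → Bool, Sum.elim x t = y ↔ x = y ∘ Sum.inl ∧ t = y ∘ Sum.inr := by
    simp [funext_iff, Sum.forall]
  simp only [State.tensor_apply, basisState, Matrix.single_apply, h]
  grind

/-- The expectation of a function of the measurement results, for a product with a basis state. -/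
theorem State.sum_tensor_basisState_diag_re [DecidableEq T] (ρ : State W) (t : T → Bool)
    (φ : (W ⊕ T → Bool) → ℝ) :
    ∑ x, φ x * (State.tensor ρ (basisState t) x x).re = ∑ x, φ (Sum.elim x t) * (ρ x x).re := by
  refine (Fintype.sum_of_injective (fun x : W → Bool => Sum.elim x t) ?_ _ _ ?_ ?_).symm
  · intro x y h
    ext w
    exact congrFun h (Sum.inl w)
  · intro x hx
    have : t ≠ x ∘ Sum.inr := by
      rintro rfl
      exact hx ⟨x ∘ Sum.inl, Sum.elim_comp_inl_inr x⟩
    simp [State.tensor_apply, basisState, this]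
  · intro x
    simp [State.tensor_apply, basisState]

end Workspace

/-! ### Classical gates -/

section Classical

variable {W : Type}

/-- The gate that measures two wires in the computational basis and replaces the result `y` by
`f y`. Its Kraus operators are `|f y⟩⟨y|`. -/
noncomputable def classicalGate (e : Fin 2 ↪ W) (f : (Fin 2 → Bool) → Fin 2 → Bool) : Gate W where
  arity := 2
  arity_le := le_rfl
  wires := e
  rank := Fintype.card (Fin 2 → Bool)
  kraus j := Matrix.single (f ((Fintype.equivFin _).symm j)) ((Fintype.equivFin _).symm j) 1
  complete := by
    rw [Equiv.sum_comp (Fintype.equivFin (Fin 2 → Bool)).symm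
      fun y => (Matrix.single (f y) y (1 : ℂ))ᴴ * Matrix.single (f y) y 1]
    simp [Matrix.sum_single_one]

theorem classicalGate_kraus (e : Fin 2 ↪ W) (f : (Fin 2 → Bool) → Fin 2 → Bool)
    (j : Fin (Fintype.card (Fin 2 → Bool))) (a b : Fin 2 → Bool) :
    (classicalGate e f).kraus j a b =
      if f ((Fintype.equivFin _).symm j) = a ∧ (Fintype.equivFin _).symm j = b then 1 else 0 :=
  Matrix.single_apply ..

theorem classicalGate_isComputationalBasis (e : Fin 2 ↪ W)
    (f : (Fin 2 → Bool) → Fin 2 → Bool) : (classicalGate e f).IsComputationalBasis :=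
  fun _ => ⟨_, _, _, rfl⟩

/-- A classical gate transforms the distribution of the measurement outcomes of all wires as the
function that it computes. -/
theorem sum_classicalGate_diag_re [Fintype W] [DecidableEq W] (e : Fin 2 ↪ W)
    (f : (Fin 2 → Bool) → Fin 2 → Bool)
    (ρ : State W) (φ : (W → Bool) → ℝ) :
    ∑ x, φ x * ((classicalGate e f).apply ρ x x).re =
      ∑ x, φ (Function.extend e (f (x ∘ e)) x) * (ρ x x).re := by
  classical
  let ι := Fintype.equivFin (Fin 2 → Bool)
  have hF : ∀ x y : W → Bool, Function.extend e (f (y ∘ e)) y = x ↔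
      (∀ w, w ∉ Set.range e → x w = y w) ∧ f (y ∘ e) = x ∘ e := by
    intro x y
    constructor
    · rintro rfl
      refine ⟨fun w hw => Function.extend_apply' _ _ _ hw, ?_⟩
      ext i
      simp [e.injective.extend_apply]
    · rintro ⟨h, h'⟩
      ext w
      by_cases hw : w ∈ Set.range e
      · obtain ⟨i, rfl⟩ := hw
        rw [e.injective.extend_apply, h']
        rfl
      · rw [Function.extend_apply' _ _ _ hw, h w hw]
  have hE : ∀ (j) (x y : W → Bool), (classicalGate e f).extend j x y =
      if Function.extend e (f (y ∘ e)) y = x ∧ ι.symm j = y ∘ e then 1 else 0 := by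
    intro j x y
    simp only [hF, and_assoc]
    by_cases hoff : ∀ w, w ∉ Set.range e → x w = y w
    · refine (Gate.extend_of_agree (classicalGate e f) j hoff).trans ?_
      have hk := classicalGate_kraus e f j (x ∘ e) (y ∘ e)
      have hiff : (f (ι.symm j) = x ∘ e ∧ ι.symm j = y ∘ e) ↔
          (∀ w, w ∉ Set.range e → x w = y w) ∧ f (y ∘ e) = x ∘ e ∧ ι.symm j = y ∘ e := by
        rw [and_iff_right hoff]
        exact and_congr_left fun h => by rw [h]
      rw [if_congr hiff rfl rfl] at hk
      exact hk
    · rw [if_neg fun h => hoff h.1]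
      exact Gate.extend_of_not_agree (classicalGate e f) j hoff
  have hdiag : ∀ x, (classicalGate e f).apply ρ x x =
      ∑ y, if Function.extend e (f (y ∘ e)) y = x then ρ y y else 0 := by
    intro x
    have h1 : ∀ j, ((classicalGate e f).extend j * ρ * ((classicalGate e f).extend j)ᴴ) x x =
        ∑ y, if Function.extend e (f (y ∘ e)) y = x ∧ ι.symm j = y ∘ e then ρ y y else 0 := by
      intro j
      rw [Matrix.mul_apply]
      refine Finset.sum_congr rfl fun z _ => ?_
      rw [Matrix.mul_apply, Matrix.conjTranspose_apply, hE]
      split_ifs with hz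
      · rw [star_one, mul_one, Finset.sum_eq_single z]
        · rw [hE, if_pos hz, one_mul]
        · intro y _ hyz
          rw [hE, if_neg, zero_mul]
          rintro ⟨hy, hy'⟩
          refine hyz (funext fun w => ?_)
          by_cases hw : w ∈ Set.range e
          · obtain ⟨i, rfl⟩ := hw
            exact congrFun (hy'.symm.trans hz.2) i
          · rw [← ((hF x y).1 hy).1 w hw, ((hF x z).1 hz.1).1 w hw]
        · simp
      · simp
    rw [Gate.apply, Matrix.sum_apply, Finset.sum_congr rfl fun j _ => h1 j, Finset.sum_comm]
    refine Finset.sum_congr rfl fun y _ => ?_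
    refine (Equiv.sum_comp ι.symm fun k => if Function.extend e (f (y ∘ e)) y = x ∧ k = y ∘ e
      then ρ y y else 0).trans ?_
    simp [ite_and]
  simp_rw [hdiag, Complex.re_sum, Finset.mul_sum]
  rw [Finset.sum_comm]
  refine Finset.sum_congr rfl fun y _ => ?_
  simp [apply_ite Complex.re]

/-- The classical gate that adds the bit on wire `a` to the bit on wire `b`. -/
noncomputable def xorGate (a b : W) (h : a ≠ b) : Gate W :=
  classicalGate ⟨![a, b], by
    intro i j
    fin_cases i <;> fin_cases j <;> simp [h, h.symm]⟩ fun y => ![y 0, xor (y 0) (y 1)]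

theorem xorGate_map {V : Type} (a b : W) (h : a ≠ b) (e : W ↪ V) :
    (xorGate a b h).map e = xorGate (e a) (e b) (e.injective.ne h) := by
  unfold xorGate classicalGate Gate.map
  congr 1
  ext i
  fin_cases i <;> rfl

theorem sum_xorGate_diag_re [Fintype W] [DecidableEq W] (a b : W) (h : a ≠ b)
    (ρ : State W) (φ : (W → Bool) → ℝ) :
    ∑ x, φ x * ((xorGate a b h).apply ρ x x).re =
      ∑ x, φ (Function.update x b (xor (x a) (x b))) * (ρ x x).re := by
  rw [xorGate, sum_classicalGate_diag_re]
  refine Finset.sum_congr rfl fun x _ => ?_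
  congr 2
  ext w
  generalize_proofs pf
  set e : Fin 2 ↪ W := ⟨![a, b], pf⟩
  by_cases hw : w ∈ Set.range e
  · obtain ⟨i, rfl⟩ := hw
    rw [e.injective.extend_apply]
    fin_cases i
    · simp [e, h]
    · simp [e]
  · rw [Function.extend_apply' _ _ _ hw, Function.update_of_ne]
    rintro rfl
    exact hw ⟨1, rfl⟩

end Classical

/-! ### Fidelity with the GHZ state and measurement statistics -/

section Fidelity

variable {W S : Type} [Fintype W] [DecidableEq W] [Fintype S] [DecidableEq S]

open Classical in
/-- Negate all bits on the wires in the range of `e`. -/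
noncomputable def flipOn {W S : Type} (e : S ↪ W) (x : W → Bool) : W → Bool :=
  fun w => if w ∈ Set.range e then !x w else x w

theorem flipOn_of_mem {W S : Type} (e : S ↪ W) (x : W → Bool) (s : S) :
    flipOn e x (e s) = !x (e s) := if_pos ⟨s, rfl⟩

theorem flipOn_of_notMem {W S : Type} (e : S ↪ W) (x : W → Bool) {w : W}
    (hw : w ∉ Set.range e) : flipOn e x w = x w := if_neg hw

theorem flipOn_involutive {W S : Type} (e : S ↪ W) : Function.Involutive (flipOn e) := by
  intro x
  ext w
  by_cases hw : w ∈ Set.range e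
  · obtain ⟨s, rfl⟩ := hw
    rw [flipOn_of_mem, flipOn_of_mem, Bool.not_not]
  · rw [flipOn_of_notMem e _ hw, flipOn_of_notMem e _ hw]

/-- All bits on the wires in the range of `e` agree. -/
def AgreeOn {W S : Type} (e : S ↪ W) (x : W → Bool) : Prop := ∀ s t, x (e s) = x (e t)

theorem agreeOn_flipOn {W S : Type} (e : S ↪ W) (x : W → Bool) :
    AgreeOn e (flipOn e x) ↔ AgreeOn e x := by
  simp [AgreeOn, flipOn_of_mem]

theorem agreeOn_iff {W S : Type} [Nonempty S] (e : S ↪ W) (x : W → Bool) :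
    AgreeOn e x ↔ x ∘ e = (fun _ => false) ∨ x ∘ e = fun _ => true := by
  constructor
  · intro h
    obtain ⟨s⟩ := ‹Nonempty S›
    cases hs : x (e s)
    · exact .inl (funext fun t => (h t s).trans hs)
    · exact .inr (funext fun t => (h t s).trans hs)
  · rintro (h | h) s t
    · exact (congrFun h s).trans (congrFun h t).symm
    · exact (congrFun h s).trans (congrFun h t).symm

open Classical in
/-- The fidelity of a reduced state with the GHZ state only involves the diagonal entries of the
global state at basis states constant on the subsystem, and the coherences between such a basis
state and the one with the subsystem flipped. -/
theorem ghzFidelity_reduced [Nonempty S] (ρ : State W) (e : S ↪ W) :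
    ghzFidelity (ρ.reduced e) =
      (∑ x, if AgreeOn e x then (ρ x x).re + (ρ x (flipOn e x)).re else 0) / 2 := by
  obtain ⟨s₀⟩ := ‹Nonempty S›
  have : Nonempty S := ⟨s₀⟩
  have hg : ∀ x : W → Bool, ghz S (x ∘ e) =
      if AgreeOn e x then ((1 / Real.sqrt 2 : ℝ) : ℂ) else 0 := by
    intro x
    by_cases hx : AgreeOn e x
    · rw [if_pos hx]
      exact if_pos ((agreeOn_iff e x).1 hx)
    · rw [if_neg hx]
      exact if_neg fun h => hx ((agreeOn_iff e x).2 h)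
  have hexp : star (ghz S) ⬝ᵥ (ρ.reduced e *ᵥ ghz S) = ∑ x, ∑ y,
      if ∀ w, w ∉ Set.range e → x w = y w then
        star (ghz S (x ∘ e)) * ρ x y * ghz S (y ∘ e) else 0 := by
    have h1 : ∀ a b, star (ghz S a) * (ρ.reduced e a b * ghz S b) = ∑ x, ∑ y,
        if x ∘ e = a then if y ∘ e = b then if ∀ w, w ∉ Set.range e → x w = y w then
          star (ghz S a) * ρ x y * ghz S b else 0 else 0 else 0 := by
      intro a b
      simp only [State.reduced, Matrix.of_apply, Finset.mul_sum, Finset.sum_mul]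
      refine Finset.sum_congr rfl fun x _ => Finset.sum_congr rfl fun y _ => ?_
      simp only [← ite_and]
      split_ifs <;> simp_all [mul_assoc]
    simp only [dotProduct, Matrix.mulVec, Finset.mul_sum, Pi.star_apply, h1]
    -- The sums over the labels `a`, `b` are moved inside, where only one summand is left.
    rw [Finset.sum_congr rfl fun a _ => Finset.sum_comm, Finset.sum_comm]
    refine Finset.sum_congr rfl fun x _ => ?_
    rw [Finset.sum_congr rfl fun a _ => Finset.sum_comm, Finset.sum_comm]
    refine Finset.sum_congr rfl fun y _ => ?_
    simp
  have hinner : ∀ x, (∑ y, if ∀ w, w ∉ Set.range e → x w = y w then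
        star (ghz S (x ∘ e)) * ρ x y * ghz S (y ∘ e) else 0) =
      if AgreeOn e x then (ρ x x + ρ x (flipOn e x)) / 2 else 0 := by
    intro x
    by_cases hx : AgreeOn e x
    · have hne : x ≠ flipOn e x := by
        intro h
        have := congrFun h (e s₀)
        rw [flipOn_of_mem] at this
        simp at this
      have hsq : ((Real.sqrt 2 : ℝ) : ℂ)⁻¹ * ((Real.sqrt 2 : ℝ) : ℂ)⁻¹ = 1 / 2 := by
        rw [← mul_inv, ← Complex.ofReal_mul, Real.mul_self_sqrt (by norm_num)]
        norm_num
      rw [if_pos hx, ← Finset.sum_subset (Finset.subset_univ {x, flipOn e x}),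
        Finset.sum_pair hne]
      · rw [if_pos fun _ _ => rfl, if_pos fun w hw => (flipOn_of_notMem e x hw).symm, hg, hg,
          if_pos hx, if_pos ((agreeOn_flipOn e x).2 hx)]
        simp
        linear_combination (ρ x x + ρ x (flipOn e x)) * hsq
      · intro y _ hy
        simp only [Finset.mem_insert, Finset.mem_singleton, not_or] at hy
        rw [hg y]
        by_cases hyc : AgreeOn e y
        · rw [if_neg]
          intro h
          by_cases h0 : x (e s₀) = y (e s₀)
          · refine hy.1 (funext fun w => ?_)
            by_cases hw : w ∈ Set.range e
            · obtain ⟨s, rfl⟩ := hw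
              rw [hyc s s₀, hx s s₀, h0]
            · exact (h w hw).symm
          · refine hy.2 (funext fun w => ?_)
            by_cases hw : w ∈ Set.range e
            · obtain ⟨s, rfl⟩ := hw
              rw [flipOn_of_mem, hyc s s₀, hx s s₀]
              exact Bool.eq_not.2 (Ne.symm h0)
            · rw [flipOn_of_notMem e x hw, h w hw]
        · simp [if_neg hyc]
    · simp [hg, hx]
  rw [ghzFidelity, hexp, Finset.sum_congr rfl fun x _ => hinner x, Complex.re_sum, Finset.sum_div]
  refine Finset.sum_congr rfl fun x _ => ?_
  split_ifs <;> simp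

theorem sum_comp_flipOn {W S : Type} [Fintype W] [DecidableEq W] (e : S ↪ W)
    (φ : (W → Bool) → ℝ) : ∑ x, φ (flipOn e x) = ∑ x, φ x :=
  Equiv.sum_comp (flipOn_involutive e).toPerm φ

open Classical in
/-- Qubits in a GHZ state give equal results when they are measured in the computational basis. -/
theorem State.IsDensity.ghzFidelity_le_prob_agreeOn [Nonempty S] {ρ : State W} (h : ρ.IsDensity)
    (e : S ↪ W) :
    ghzFidelity (ρ.reduced e) ≤ ∑ x, if AgreeOn e x then (ρ x x).re else 0 := by
  have hflip := sum_comp_flipOn e fun x => if AgreeOn e x then (ρ x x).re else 0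
  -- By positivity on `|x⟩ - |flipOn e x⟩`, the coherence is at most the mean of the two weights.
  have hle : (∑ x, if AgreeOn e x then (ρ x x).re + (ρ x (flipOn e x)).re else 0) ≤
      ∑ x, ((if AgreeOn e x then 3 / 2 * (ρ x x).re else 0) +
        1 / 2 * if AgreeOn e (flipOn e x) then (ρ (flipOn e x) (flipOn e x)).re else 0) := by
    refine Finset.sum_le_sum fun x _ => ?_
    rw [if_congr (agreeOn_flipOn e x) rfl rfl]
    split_ifs
    · linarith [h.offDiag_re_le x (flipOn e x) 1]
    · simp
  rw [Finset.sum_add_distrib, ← Finset.mul_sum, hflip] at hle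
  have : (∑ x, if AgreeOn e x then 3 / 2 * (ρ x x).re else 0) =
      3 / 2 * ∑ x, if AgreeOn e x then (ρ x x).re else 0 := by
    rw [Finset.mul_sum]
    exact Finset.sum_congr rfl fun x _ => (mul_ite_zero ..).symm
  rw [ghzFidelity_reduced]
  linarith

/-- Two qubits of a GHZ state disagree with small probability. -/
theorem State.IsDensity.prob_ne_le [Nonempty S] {ρ : State W} (h : ρ.IsDensity) (e : S ↪ W)
    (s t : S) :
    (∑ x, if x (e s) ≠ x (e t) then (ρ x x).re else 0) ≤ 1 - ghzFidelity (ρ.reduced e) := by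
  classical
  have h1 := h.ghzFidelity_le_prob_agreeOn e
  rw [le_sub_comm]
  refine h1.trans ?_
  rw [← h.sum_diag_re, ← Finset.sum_sub_distrib]
  refine Finset.sum_le_sum fun x _ => ?_
  have := h.diag_re_nonneg x
  by_cases hx : AgreeOn e x
  · simp [if_pos hx, hx s t]
  · rw [if_neg hx]
    split_ifs <;> linarith

/-- Monogamy of the GHZ state: a qubit outside of a subsystem that is close to a GHZ state
disagrees with each qubit of the subsystem with probability bounded away from zero. The bound,
which is not optimal, is positive when the fidelity exceeds `3 / 4`. -/
theorem State.IsDensity.le_prob_ne [Nonempty S] {ρ : State W} (h : ρ.IsDensity) (e : S ↪ W)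
    (s : S) {v : W} (hv : v ∉ Set.range e) :
    (4 * ghzFidelity (ρ.reduced e) - 3) / 3 ≤
      ∑ x, if x (e s) ≠ x v then (ρ x x).re else 0 := by
  classical
  -- The flip negates the bit on `e s` and keeps that on `v`: it exchanges agreement and difference.
  have hE : ∀ x, flipOn e x (e s) = flipOn e x v ↔ x (e s) ≠ x v := by
    intro x
    rw [flipOn_of_mem, flipOn_of_notMem e x hv]
    cases x (e s) <;> cases x v <;> simp
  set T₁ := ∑ x, if AgreeOn e x ∧ x (e s) = x v then (ρ x x).re else 0 with hT₁
  set T₂ := ∑ x, if AgreeOn e x ∧ x (e s) ≠ x v then (ρ x x).re else 0 with hT₂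
  set D := ∑ x, if AgreeOn e x ∧ x (e s) = x v then (ρ x (flipOn e x)).re else 0 with hD
  have hD' : (∑ x, if AgreeOn e x ∧ x (e s) ≠ x v then (ρ x (flipOn e x)).re else 0) = D := by
    rw [hD, ← sum_comp_flipOn e]
    refine Finset.sum_congr rfl fun x _ => ?_
    rw [flipOn_involutive e x, h.re_apply_comm x]
    refine if_congr (and_congr (agreeOn_flipOn e x) ?_) rfl rfl
    rw [Ne, hE, Ne, not_not]
  have hT₂' : (∑ x, if AgreeOn e x ∧ x (e s) = x v then
      (ρ (flipOn e x) (flipOn e x)).re else 0) = T₂ := by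
    rw [hT₂, ← sum_comp_flipOn e fun x =>
      if AgreeOn e x ∧ x (e s) ≠ x v then (ρ x x).re else 0]
    refine Finset.sum_congr rfl fun x _ => ?_
    refine if_congr (and_congr (agreeOn_flipOn e x).symm ?_) rfl rfl
    rw [Ne, hE, Ne, not_not]
  have hF : ghzFidelity (ρ.reduced e) = (T₁ + T₂ + 2 * D) / 2 := by
    rw [ghzFidelity_reduced, two_mul]
    nth_rewrite 2 [← hD']
    rw [hT₁, hT₂, hD, ← Finset.sum_add_distrib, ← Finset.sum_add_distrib,
      ← Finset.sum_add_distrib]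
    congr 1
    refine Finset.sum_congr rfl fun x _ => ?_
    by_cases hx : AgreeOn e x <;> by_cases hxe : x (e s) = x v <;> simp [hx, hxe]
  -- Positivity on `|x⟩ - 2 |flipOn e x⟩`. The symmetric vector `|x⟩ - |flipOn e x⟩` would only give
  -- `ghzFidelity (ρ.reduced e) ≤ T₁ + T₂`, and no lower bound for `T₂` alone.
  have hpos : 4 * D ≤ T₁ + 4 * T₂ := by
    rw [← hT₂', hT₁, hD, Finset.mul_sum, Finset.mul_sum, ← Finset.sum_add_distrib]
    refine Finset.sum_le_sum fun x _ => ?_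
    split_ifs
    · linarith [h.offDiag_re_le x (flipOn e x) 2]
    · simp
  have htot : T₁ + T₂ ≤ 1 := by
    rw [← h.sum_diag_re, hT₁, hT₂, ← Finset.sum_add_distrib]
    refine Finset.sum_le_sum fun x _ => ?_
    have := h.diag_re_nonneg x
    by_cases hx : AgreeOn e x <;> by_cases hxe : x (e s) = x v <;> simp [hx, hxe, this]
  have hle : T₂ ≤ ∑ x, if x (e s) ≠ x v then (ρ x x).re else 0 := by
    refine Finset.sum_le_sum fun x _ => ?_
    have := h.diag_re_nonneg x
    by_cases hx : AgreeOn e x <;> by_cases hxe : x (e s) = x v <;> simp [hx, hxe, this]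
  linarith

end Fidelity

/-! ### The adversary -/

section Attack

variable {n : ℕ} (P : Protocol n)

theorem Protocol.isDensity_honestRun (d : Fin n → Bool) : (P.honestRun d).IsDensity :=
  (isDensity_basisState _).runSteps _ _ _

open Classical in
/-- The adversary that corrupts the applicants `i` and `j`, follows the protocol, and then computes
the parity of the two output bits in its only workspace qubit. Its challenges are the supports
`{i, j, k}` (for the bit `false`) and `{i, k}` (for `true`). -/
noncomputable def parityAdversary (i j k : Fin n) : Adversary P where
  M := {i, j}
  corruptServer := false
  d c m := decide (m = i ∨ m = k ∨ (c = false ∧ m = j))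
  workspace := 1
  act s :=
    if hs : Corrupted {i, j} false (P.active s) then
      (P.act s).map
        { toFun := fun q => Sum.inl ⟨⟨P.active s, q⟩, hs⟩
          inj' := fun q q' h => by simpa using h }
    -- In the steps of honest parties the circuit chosen here is not used.
    else []
  final :=
    [xorGate (Sum.inl ⟨P.outputWire i, Finset.mem_insert_self i {j}⟩) (Sum.inr 0)
        Sum.inl_ne_inr,
      xorGate (Sum.inl ⟨P.outputWire j,
        Finset.mem_insert_of_mem (Finset.mem_singleton_self j)⟩) (Sum.inr 0)
        Sum.inl_ne_inr]
  guess := 0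

theorem parityAdversary_followsProtocol (i j k : Fin n) :
    (parityAdversary P i j k).FollowsProtocol :=
  fun _ hs => dif_pos hs

theorem parityAdversary_measuresComputationalBasis (i j k : Fin n) :
    (parityAdversary P i j k).MeasuresComputationalBasis := by
  intro g hg
  rcases List.mem_cons.1 hg with rfl | hg
  · exact classicalGate_isComputationalBasis _ _
  · obtain rfl := List.mem_singleton.1 hg
    exact classicalGate_isComputationalBasis _ _

theorem parityAdversary_size_le (i j k : Fin n) : (parityAdversary P i j k).size ≤ P.size + 3 := by
  have hact : ∀ s, ((parityAdversary P i j k).act s).length ≤ (P.act s).length := by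
    intro s
    unfold parityAdversary
    dsimp only
    split_ifs
    · simp [Circuit.map]
    · simp
  have hsum := Finset.sum_le_sum fun s (_ : s ∈ Finset.univ) => hact s
  have hws : (parityAdversary P i j k).workspace = 1 := rfl
  have hfin : (parityAdversary P i j k).final.length = 2 := rfl
  rw [Adversary.size, Protocol.size]
  omega

theorem parityAdversary_admissible {i j k : Fin n} (hik : k ≠ i) (hjk : k ≠ j) :
    (parityAdversary P i j k).Admissible :=
  fun c => ⟨k, by simp [parityAdversary, hik, hjk], by simp [parityAdversary]⟩

theorem Adversary.FollowsProtocol.stepCircuit_eq {P : Protocol n} {A : Adversary P}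
    (hA : A.FollowsProtocol) (s : Fin P.steps) :
    A.stepCircuit s =
      ((P.act s).map (P.register (P.active s))).map Function.Embedding.inl := by
  unfold Adversary.stepCircuit
  split_ifs with hs
  · rw [hA s hs]
    simp only [Circuit.map, List.map_map]
    rfl
  · simp only [Circuit.map, List.map_map]
    rfl

/-- If the corrupted parties follow the protocol, then the run is an honest one, next to which
the workspace is idle. -/
theorem Adversary.FollowsProtocol.attackedRun_eq {P : Protocol n} {A : Adversary P}
    (hA : A.FollowsProtocol) (d : Fin n → Bool) :
    A.attackedRun d = (A.final.map A.heldWires).apply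
      (State.tensor (P.honestRun d) (basisState fun _ => false)) := by
  rw [Adversary.attackedRun, funext hA.stepCircuit_eq, basisState_sumElim, runSteps_tensor]
  rfl

/-- Adding two bits to a fresh qubit leaves their parity there. -/
theorem probBit_xorGate_xorGate {W T : Type} [Fintype W] [DecidableEq W] [Fintype T]
    [DecidableEq T] (ρ : State W) (a b : W) (t : T) (c : Bool) :
    ((xorGate (Sum.inl b) (Sum.inr t) Sum.inl_ne_inr).apply
      ((xorGate (Sum.inl a) (Sum.inr t) Sum.inl_ne_inr).apply
        (State.tensor ρ (basisState fun _ => false)))).probBit (Sum.inr t) c =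
      ∑ x, if xor (x a) (x b) = c then (ρ x x).re else 0 := by
  have hprob : ∀ σ : State (W ⊕ T), σ.probBit (Sum.inr t) c =
      ∑ x, (if x (Sum.inr t) = c then 1 else 0) * (σ x x).re := by
    simp [State.probBit]
  rw [hprob, sum_xorGate_diag_re _ _ _ _ fun x => if x (Sum.inr t) = c then 1 else 0,
    sum_xorGate_diag_re _ _ _ _ fun x => if Function.update x (Sum.inr t)
      (xor (x (Sum.inl b)) (x (Sum.inr t))) (Sum.inr t) = c then 1 else 0,
    State.sum_tensor_basisState_diag_re]
  refine Finset.sum_congr rfl fun x _ => ?_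
  rw [Function.update_self, Function.update_self, Function.update_of_ne Sum.inl_ne_inr]
  simp only [Sum.elim_inl, Sum.elim_inr, Bool.xor_false, ite_mul, one_mul, zero_mul]
  rw [Bool.xor_comm]

/-- The guess of the adversary is the parity of the two output bits in an honest run. -/
theorem parityAdversary_probBit (i j k : Fin n) (d : Fin n → Bool) (b : Bool) :
    ((parityAdversary P i j k).attackedRun d).probBit (Sum.inr (parityAdversary P i j k).guess) b =
      ∑ x, if xor (x (P.outputWire i)) (x (P.outputWire j)) = b then
        (P.honestRun d x x).re else 0 := by
  have hfin : (parityAdversary P i j k).final.map (parityAdversary P i j k).heldWires =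
      [xorGate (Sum.inl (P.outputWire i)) (Sum.inr (parityAdversary P i j k).guess)
          Sum.inl_ne_inr,
        xorGate (Sum.inl (P.outputWire j)) (Sum.inr (parityAdversary P i j k).guess)
          Sum.inl_ne_inr] :=
    congrArg₂ List.cons (xorGate_map ..) (congrArg₂ List.cons (xorGate_map ..) rfl)
  rw [(parityAdversary_followsProtocol P i j k).attackedRun_eq, hfin]
  exact probBit_xorGate_xorGate ..

/-- The adversary is right with probability at least `1 - δ` on the support `{i, j, k}` and
`1 / 3 - 4 / 3 * δ` on the support `{i, k}`. -/
theorem le_parityAdversary_winProb {i j k : Fin n} (hij : i ≠ j) (hki : k ≠ i) (hkj : k ≠ j)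
    {δ : ℝ} (hP : ∀ d : Fin n → Bool, (∃ m, d m = true) →
      1 - δ ≤ ghzFidelity (P.supportedState d)) :
    2 / 3 - 7 / 6 * δ ≤ (parityAdversary P i j k).winProb := by
  have hdi : ∀ c, (parityAdversary P i j k).d c i = true := by simp [parityAdversary]
  have hd0j : (parityAdversary P i j k).d false j = true := by simp [parityAdversary]
  have hd1j : (parityAdversary P i j k).d true j = false := by
    simp [parityAdversary, hij.symm, hkj.symm]
  have hF := fun c => hP ((parityAdversary P i j k).d c) ⟨i, hdi c⟩
  rw [Adversary.winProb, if_pos (parityAdversary_admissible P hki hkj), Fintype.sum_bool,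
    parityAdversary_probBit, parityAdversary_probBit]
  generalize (parityAdversary P i j k).d = d at *
  have hD := fun c => P.isDensity_honestRun (d c)
  have : ∀ c, Nonempty {m : Fin n // d c m = true} := fun c => ⟨i, hdi c⟩
  have h0 := (hD false).prob_ne_le
    ((Function.Embedding.subtype fun m => d false m = true).trans P.outputWire)
    ⟨i, hdi false⟩ ⟨j, hd0j⟩
  have h1 := (hD true).le_prob_ne
    ((Function.Embedding.subtype fun m => d true m = true).trans P.outputWire)
    ⟨i, hdi true⟩ (v := P.outputWire j) (by
      rintro ⟨m, hm⟩
      have hmj : (m : Fin n) = j := P.outputWire.injective hm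
      have := m.2
      rw [hmj, hd1j] at this
      cases this)
  have hw : ∀ m c hm, ((Function.Embedding.subtype fun m => d c m = true).trans P.outputWire)
      ⟨m, hm⟩ = P.outputWire m := fun _ _ _ => rfl
  rw [hw, hw] at h0
  rw [hw] at h1
  have hF0 := hF false
  have hF1 := hF true
  rw [Protocol.supportedState] at hF0 hF1
  have hxor : (∑ x, if xor (x (P.outputWire i)) (x (P.outputWire j)) = true then
      (P.honestRun (d true) x x).re else 0) =
        ∑ x, if x (P.outputWire i) ≠ x (P.outputWire j) then
          (P.honestRun (d true) x x).re else 0 :=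
    Finset.sum_congr rfl fun x _ => if_congr (by simp) rfl rfl
  have hxnor : (∑ x, if xor (x (P.outputWire i)) (x (P.outputWire j)) = false then
      (P.honestRun (d false) x x).re else 0) =
        1 - ∑ x, if x (P.outputWire i) ≠ x (P.outputWire j) then
          (P.honestRun (d false) x x).re else 0 := by
    rw [← (hD false).sum_diag_re, ← Finset.sum_sub_distrib]
    refine Finset.sum_congr rfl fun x _ => ?_
    by_cases h : x (P.outputWire i) = x (P.outputWire j) <;> simp [h]
  rw [hxor, hxnor]
  linarith

theorem Negligible.tendsto_zero {ν : ℕ → ℝ} (h : Negligible ν) :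
    Filter.Tendsto ν Filter.atTop (nhds 0) := by
  simpa using h 0

theorem exists_adversary_of_isCorrect {n : ℕ → ℕ} (hn : ∀ l, 3 ≤ n l) {P : ∀ l, Protocol (n l)}
    (hP : IsCorrect P) :
    ∃ A : ∀ l, Adversary (P l),
      (∀ l, (A l).corruptServer = false ∧
        (∀ i, i ∉ (A l).M → (A l).d false i = (A l).d true i) ∧
        (A l).FollowsProtocol ∧ (A l).MeasuresComputationalBasis) ∧
      (IsQPTProtocol P → IsQPTAdversary A) ∧ ¬ HasNegligibleAdvantage A := by
  have hlt : ∀ l, 0 < n l ∧ 1 < n l ∧ 2 < n l := fun l => by have := hn l; omega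
  refine ⟨fun l => parityAdversary (P l) ⟨0, (hlt l).1⟩ ⟨1, (hlt l).2.1⟩ ⟨2, (hlt l).2.2⟩,
    fun l => ⟨rfl, ?_, parityAdversary_followsProtocol _ _ _ _,
      parityAdversary_measuresComputationalBasis _ _ _ _⟩, ?_, ?_⟩
  · intro i hi
    simp only [parityAdversary, Finset.mem_insert, Finset.mem_singleton, not_or] at hi ⊢
    simp [hi.2]
  · rintro ⟨p, hp⟩
    refine ⟨p + 3, fun l => (parityAdversary_size_le _ _ _ _).trans ?_⟩
    have := hp l
    simpa using this
  · rintro ⟨ν, hν, hwin⟩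
    obtain ⟨δ, hδ, hF⟩ := hP
    have hlim : Filter.Tendsto (fun l => ν l + 7 / 6 * δ l) Filter.atTop (nhds 0) := by
      simpa using hν.tendsto_zero.add (hδ.tendsto_zero.const_mul (7 / 6))
    obtain ⟨l, hl⟩ := (hlim.eventually_lt_const (show (0 : ℝ) < 1 / 6 by norm_num)).exists
    have h1 := hwin l
    have h2 := le_parityAdversary_winProb (P l) (i := ⟨0, (hlt l).1⟩) (j := ⟨1, (hlt l).2.1⟩)
      (k := ⟨2, (hlt l).2.2⟩) (by simp) (by simp) (by simp) (hF l)
    linarith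

end Attack
end BlindCan

theorem mainTheorem9 (n : ℕ → ℕ) (hn : ∀ l, 3 ≤ n l) :
    (¬ ∃ P : ∀ l, BlindCan.Protocol (n l),
      BlindCan.IsQPTProtocol P ∧ BlindCan.IsCorrect P ∧ BlindCan.HidesSupportStatus P) ∧
    ∀ P : ∀ l, BlindCan.Protocol (n l), BlindCan.IsCorrect P →
      ∃ A : ∀ l, BlindCan.Adversary (P l),
        (∀ l, (A l).corruptServer = false ∧
          (∀ i, i ∉ (A l).M → (A l).d false i = (A l).d true i) ∧
          (A l).FollowsProtocol ∧ (A l).MeasuresComputationalBasis) ∧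
        (BlindCan.IsQPTProtocol P → BlindCan.IsQPTAdversary A) ∧
        ¬ BlindCan.HasNegligibleAdvantage A := by
  have attack := fun P hP => BlindCan.exists_adversary_of_isCorrect hn (P := P) hP
  refine ⟨?_, attack⟩
  rintro ⟨P, hQPT, hcorrect, hsecure⟩
  obtain ⟨A, -, hA, hadv⟩ := attack P hcorrect
  exact hadv (hsecure A (hA hQPT))
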